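/- **Model.** In the synchronous $n$-clique, $n$ nodes carry distinct integer IDs, chosen by an adversary from an ID universe $U\subseteq\mathbb Z$. Each node has $n-1$ ports, which lead to the $n-1$ other nodes according to an arbitrary port mapping chosen by the adversary. Initially a node knows only $n$, its own ID and a private infinite sequence of fair coin flips, independent between nodes. All nodes start in round $1$. In each round every node that has not terminated may send one message (a finite bit string) over each of its ports, all messages of the round are delivered in that round, and then a node may terminate with an irrevocable output. Local computation is unrestricted; terminated nodes send nothing. In *implicit* leader election each node outputs one bit, and exactly one of the bits must be $1$; in *explicit* leader election all nodes must output the ID of one and the same node. An algorithm is *Las Vegas* (for the universe $U$) if for every assignment of distinct IDs from $U$ and every port mapping, with probability $1$ all nodes terminate and their outputs are correct. Messages are counted over the whole execution. **Theorem.** 1. There is a constant $c>0$ such that for every $n\ge 2$ and every ID universe $U\subseteq\mathbb Z$ with $|U|\ge 3n$, every randomized Las Vegas algorithm for implicit leader election on the synchronous $n$-clique with IDs from $U$ sends at least $c\,n$ messages in expectation, for some assignment of distinct IDs from $U$ and some port mapping. 2. Conversely, for every $k\in\mathbb N$ there are a constant $C$ and, for every $n\ge1$, a randomized algorithm on the synchronous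 $n$-clique which is Las Vegas for explicit leader election with the ID universe $\mathbb Z$ and which, for every assignment of distinct IDs and every port mapping, with probability at least $1-n^{-k}$ sends at most $C\,n$ messages in total and has all nodes terminated by the end of round $3$. Moreover, each of its messages has at most $C\,(b(n)+B)$ bits, where $b(n)$ is the number of binary digits of $n$ and $B$ is any upper bound on the number of binary digits of the absolute values of the IDs; that is, $O(\log n)$ bits if the IDs are bounded by a polynomial in $n$. -/

import Mathlib

open MeasureTheory

namespace CliqueElection

/-- A message: a finite bit string of arbitrary length. -/
abbrev Msg : Type := List Bool

/-- What a node of the `n`-clique receives in one round: on each of its `n - 1` ports at most one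
message. -/
abbrev Inbox (n : ℕ) : Type := Fin (n - 1) → Option Msg

/-- The private randomness of a node: an infinite sequence of coin flips. -/
abbrev Tape : Type := ℕ → Bool

/-- The law of a sequence of independent fair coin flips. -/
noncomputable def tapeLaw : Measure Tape :=
  Measure.infinitePi fun _ : ℕ => (PMF.uniformOfFintype Bool).toMeasure

/-- The joint law of the private random tapes of `n` nodes: the tapes are independent. -/
noncomputable def tapesLaw (n : ℕ) : Measure (Fin n → Tape) :=
  Measure.pi fun _ : Fin n => tapeLaw

/-- A port mapping of the `n`-clique: `link (u, i) = (v, j)` means that a message sent by `u` over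
its port `i` is received by `v` over its port `j`, and vice versa. The `n - 1` ports of a node lead
to the `n - 1` other nodes. -/
structure PortMapping (n : ℕ) where
  link : Fin n × Fin (n - 1) → Fin n × Fin (n - 1)
  link_link : ∀ x, link (link x) = x
  link_ne : ∀ x, (link x).1 ≠ x.1
  link_inj : ∀ u i j, (link (u, i)).1 = (link (u, j)).1 → i = j

/-- A randomized algorithm for the synchronous `n`-clique in which every node knows only `n`, its own
ID, its own random tape and what it has received so far. The list of inboxes has the most recent
round first, and its length is the number of completed rounds.

`decide id r h = some o` says that a node with ID `id`, tape `r` and reception history `h` terminates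
with the irrevocable output `o`. Otherwise it continues, and `send id r h i` is the message, if any,
that it sends over port `i` in the next round. The dependence on the tape has to be measurable;
local computation is not restricted otherwise. -/
structure Algorithm (n : ℕ) (Out : Type) where
  decide : ℤ → Tape → List (Inbox n) → Option Out
  send : ℤ → Tape → List (Inbox n) → Fin (n - 1) → Option Msg
  measurable_decide : ∀ id h o, MeasurableSet {r | decide id r h = o}
  measurable_send : ∀ id h i m, MeasurableSet {r | send id r h i = m}

/-- The configuration of one node: its output (`none` as long as it has not terminated) and the
inboxes of the completed rounds, most recent first. -/
structure NodeState (n : ℕ) (Out : Type) where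
  out : Option Out
  hist : List (Inbox n)

namespace Algorithm

variable {n : ℕ} {Out : Type}

/-- The message that a node in a given configuration sends over port `i` in the next round.
Terminated nodes are silent. -/
def emit (A : Algorithm n Out) (id : ℤ) (r : Tape) (s : NodeState n Out) (i : Fin (n - 1)) :
    Option Msg :=
  match s.out with
  | some _ => none
  | none => A.send id r s.hist i

/-- The configurations of all nodes after `t` rounds, under simultaneous wake-up. In every round the
nodes send, all messages of the round are delivered, and each node that has not terminated earlier
decides whether to terminate. -/
def state (A : Algorithm n Out) (ids : Fin n → ℤ) (p : PortMapping n) (ω : Fin n → Tape) :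
    ℕ → Fin n → NodeState n Out
  | 0, v => ⟨A.decide (ids v) (ω v) [], []⟩
  | t + 1, v =>
      let old := state A ids p ω t
      let inbox : Inbox n := fun i =>
        let src := p.link (v, i)
        A.emit (ids src.1) (ω src.1) (old src.1) src.2
      let hist := inbox :: (old v).hist
      ⟨(old v).out.or (A.decide (ids v) (ω v) hist), hist⟩

/-- The output of node `v` after `t` rounds; `none` if `v` has not terminated by then. -/
def output (A : Algorithm n Out) (ids : Fin n → ℤ) (p : PortMapping n) (ω : Fin n → Tape)
    (t : ℕ) (v : Fin n) : Option Out :=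
  (A.state ids p ω t v).out

/-- The message that node `v` sends over port `i` in round `t + 1`. -/
def sent (A : Algorithm n Out) (ids : Fin n → ℤ) (p : PortMapping n) (ω : Fin n → Tape)
    (t : ℕ) (v : Fin n) (i : Fin (n - 1)) : Option Msg :=
  A.emit (ids v) (ω v) (A.state ids p ω t v) i

/-- The total number of messages sent in the whole execution. -/
noncomputable def messages (A : Algorithm n Out) (ids : Fin n → ℤ) (p : PortMapping n)
    (ω : Fin n → Tape) : ENNReal :=
  ∑' t : ℕ, ((Finset.univ.filter fun x : Fin n × Fin (n - 1) =>
    (A.sent ids p ω t x.1 x.2).isSome = true).card : ENNReal)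

/-- The expected total number of messages. -/
noncomputable def expectedMessages (A : Algorithm n Out) (ids : Fin n → ℤ) (p : PortMapping n) :
    ENNReal :=
  ∫⁻ ω, A.messages ids p ω ∂(tapesLaw n)

/-- `A` is a Las Vegas algorithm, for IDs from the universe `U`, for the task that accepts the outputs
`o` under the ID assignment `ids` when `Task ids o` holds: for every assignment of distinct IDs and
every port mapping, with probability one all nodes terminate and their outputs are accepted. -/
def IsLasVegas (A : Algorithm n Out) (U : Set ℤ) (Task : (Fin n → ℤ) → (Fin n → Out) → Prop) :
    Prop :=
  ∀ ids : Fin n ↪ ℤ, (∀ v, ids v ∈ U) → ∀ p : PortMapping n,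
    ∀ᵐ ω ∂(tapesLaw n), ∃ (t : ℕ) (o : Fin n → Out),
      (∀ v, A.output ids p ω t v = some (o v)) ∧ Task ids o

end Algorithm

/-- Implicit leader election: exactly one node outputs `true`. -/
def ImplicitElection {n : ℕ} (_ids : Fin n → ℤ) (o : Fin n → Bool) : Prop :=
  ∃! v, o v = true

/-- Explicit leader election: all nodes output the ID of one and the same node, the leader. -/
def ExplicitElection {n : ℕ} (ids : Fin n → ℤ) (o : Fin n → ℤ) : Prop :=
  ∃ leader, ∀ v, o v = ids leader

end CliqueElection

open CliqueElection

namespace CliqueElection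

/-! Lower bound. A tape is silent for an ID if a node with it sends nothing as long as it receives
nothing. If `n` IDs of `U` are silent with probability 0, assign these: almost surely every node
sends or receives a message, and a message touches only two nodes, so at least `n / 2` are sent
(`card_le_two_mul_messages`). Otherwise more than `n` IDs are silent with positive probability. For
any `n` of them, by independence, all nodes are silent together with positive probability and then
decide without communication. Hence some such ID `a` silently outputs 1 with positive probability,
and so does some `b ≠ a` (`IsLasVegas.exists_leading`). If both are present, two leaders occur with
positive probability, a contradiction.

Upper bound. Let `8 ^ s ≤ n < 8 ^ (s + 1)`. Nodes are candidates with probability `4⁻¹ ^ s`, and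
each port of a candidate leads to a referee with probability `2⁻¹ ^ s`. This gives order `2 ^ s`
candidates with order `4 ^ s` referees each, hence `O(n)` messages. Two given nodes share a referee
except with probability `exp (2 - 2 ^ s)`; when all pairs do, only the best candidate announces
itself, at cost `n - 1`. As `2 ^ s` is of order `n ^ (1 / 3)`, a union bound over pairs beats every
power of `n` (`bitLottery.measure_not_good_le`, `exists_threshold`). Correctness needs no luck: all
nodes learn the same announcements, and without any there is a fallback round. -/

instance : IsProbabilityMeasure tapeLaw := by unfold tapeLaw; infer_instance

instance (n : ℕ) : IsProbabilityMeasure (tapesLaw n) := by unfold tapesLaw; infer_instance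

/-- The cyclic port mapping: port `i` of `u` leads to `u + i + 1`. -/
def cyclicPorts (n : ℕ) : PortMapping n where
  link x := (⟨(x.1 + x.2 + 1) % n, Nat.mod_lt _ (by have := x.1.2; omega)⟩,
    ⟨n - 2 - x.2, by have := x.2.2; omega⟩)
  link_link := by
    rintro ⟨⟨u, hu⟩, ⟨i, hi⟩⟩
    have h : ((u + i + 1) % n + (n - 2 - i) + 1) % n = u := by
      rw [add_assoc, Nat.mod_add_mod, show u + i + 1 + (n - 2 - i + 1) = u + n by omega]
      simp [Nat.mod_eq_of_lt hu]
    ext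
    · simpa using h
    · simp; omega
  link_ne := by
    rintro ⟨⟨u, hu⟩, ⟨i, hi⟩⟩ h
    simp only [Fin.mk.injEq] at h
    rcases lt_or_ge (u + i + 1) n with h1 | h1
    · rw [Nat.mod_eq_of_lt h1] at h; omega
    · rw [Nat.mod_eq_sub_mod h1, Nat.mod_eq_of_lt (by omega)] at h; omega
  link_inj := by
    rintro ⟨u, hu⟩ ⟨i, hi⟩ ⟨j, hj⟩ h
    simp only [Fin.mk.injEq] at h ⊢
    have h' : (u + 1) + i ≡ (u + 1) + j [MOD n] := by
      unfold Nat.ModEq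
      rw [show u + 1 + i = u + i + 1 by omega, show u + 1 + j = u + j + 1 by omega, h]
    have := Nat.ModEq.add_left_cancel' _ h'
    unfold Nat.ModEq at this
    rwa [Nat.mod_eq_of_lt (by omega), Nat.mod_eq_of_lt (by omega)] at this

/-- Enumerates an intermediate set with exactly `n` elements. The set `T` holds the IDs that an
assignment is forced to use. -/
theorem exists_embedding_between {α : Type*} {S T : Set α} {n : ℕ} (hTS : T ⊆ S)
    (hT : T.encard ≤ n) (hS : n ≤ S.encard) :
    ∃ f : Fin n ↪ α, (∀ v, f v ∈ S) ∧ ∀ x ∈ T, ∃ v, f v = x := by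
  obtain ⟨R, hTR, hRS, hR⟩ := Set.exists_superset_subset_encard_eq hTS hT hS
  have hfin : R.Finite := Set.finite_of_encard_eq_coe hR
  have := hfin.fintype
  have hc : Fintype.card R = n := by
    rw [← Nat.card_eq_fintype_card, Nat.card_coe_set_eq, Set.ncard, hR]; rfl
  let e := (Fintype.equivFinOfCardEq hc).symm
  refine ⟨e.toEmbedding.trans (Function.Embedding.subtype _), fun v => hRS (e v).2, fun x hx => ?_⟩
  exact ⟨e.symm ⟨x, hTR hx⟩, by simp⟩

namespace Algorithm

/-! ### Executions without communication -/

section Solo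

variable {n : ℕ} {Out : Type} (A : Algorithm n Out)

/-- The output after `t` rounds of a node that receives no message. -/
def soloOut (id : ℤ) (r : Tape) : ℕ → Option Out
  | 0 => A.decide id r []
  | t + 1 => (soloOut id r t).or (A.decide id r (List.replicate (t + 1) fun _ => none))

/-- The tapes with which a node that receives no message sends none either. -/
def silent (id : ℤ) : Set Tape :=
  {r | ∀ t i, A.soloOut id r t = none → A.send id r (List.replicate t fun _ => none) i = none}

/-- The tapes with which a node stays silent and gives output `o` as long as it receives nothing. -/
def silentOut (id : ℤ) (o : Out) : Set Tape :=
  A.silent id ∩ {r | ∃ t, A.soloOut id r t = some o}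

theorem soloOut_mono {id : ℤ} {r : Tape} {t t' : ℕ} {o : Out} (h : A.soloOut id r t = some o)
    (ht : t ≤ t') : A.soloOut id r t' = some o := by
  induction t', ht using Nat.le_induction with
  | base => exact h
  | succ t' _ ih => simp [soloOut, ih]

variable {A} {ids : Fin n → ℤ} {p : PortMapping n} {ω : Fin n → Tape}

theorem state_eq_solo_of_no_receipt {v : Fin n} {t : ℕ}
    (h : ∀ t' < t, ∀ i, A.sent ids p ω t' (p.link (v, i)).1 (p.link (v, i)).2 = none) :
    A.state ids p ω t v = ⟨A.soloOut (ids v) (ω v) t, List.replicate t fun _ => none⟩ := by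
  induction t with
  | zero => rfl
  | succ t ih =>
    have ih := ih fun t' ht' => h t' (by omega)
    have h1 : (fun i => A.emit (ids (p.link (v, i)).1) (ω (p.link (v, i)).1)
        (A.state ids p ω t (p.link (v, i)).1) (p.link (v, i)).2) = fun _ => none :=
      funext fun i => h t (by omega) i
    simp only [state, ih, h1, soloOut, List.replicate_succ]

/-- There is no first message: up to its round every node would be in its solo configuration, where
silence forbids sending. -/
theorem sent_eq_none_of_silent (h : ∀ v, ω v ∈ A.silent (ids v)) (t : ℕ) :
    ∀ v i, A.sent ids p ω t v i = none := by
  induction t using Nat.strong_induction_on with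
  | _ t ih =>
    intro v i
    rw [sent, state_eq_solo_of_no_receipt fun t' ht' i => ih t' ht' _ _, emit]
    cases hs : A.soloOut (ids v) (ω v) t with
    | some o => rfl
    | none => exact h v t i hs

theorem output_eq_soloOut_of_silent (h : ∀ v, ω v ∈ A.silent (ids v)) (t : ℕ) (v : Fin n) :
    A.output ids p ω t v = A.soloOut (ids v) (ω v) t := by
  rw [output, state_eq_solo_of_no_receipt fun t' _ i => sent_eq_none_of_silent h t' _ _]

/-- A node that neither sends nor receives runs through its solo configurations, so its tape passes
the test for silence. -/
theorem exists_touched_of_not_silent {v : Fin n} (h : ω v ∉ A.silent (ids v)) :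
    ∃ t x, (A.sent ids p ω t x.1 x.2).isSome = true ∧ (x.1 = v ∨ (p.link x).1 = v) := by
  by_contra! hc
  apply h
  intro t i hs
  have h1 : ∀ t' < t, ∀ i, A.sent ids p ω t' (p.link (v, i)).1 (p.link (v, i)).2 = none := by
    intro t' _ i
    by_contra hne
    exact (hc t' (p.link (v, i)) (Option.isSome_iff_ne_none.2 hne)).2 (by rw [p.link_link])
  by_contra hne
  refine (hc t (v, i) ?_).1 rfl
  rw [sent, state_eq_solo_of_no_receipt h1, emit]
  simpa [hs] using Option.isSome_iff_ne_none.2 hne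

/-- Every node is an endpoint of some message, and a message has two endpoints. -/
theorem card_le_two_mul_messages (h : ∀ v, ω v ∉ A.silent (ids v)) :
    (n : ENNReal) ≤ 2 * A.messages ids p ω := by
  classical
  let F : ℕ → Finset (Fin n × Fin (n - 1)) := fun t =>
    Finset.univ.filter fun x => (A.sent ids p ω t x.1 x.2).isSome = true
  let T : ℕ → Finset (Fin n) := fun t => (F t).image Prod.fst ∪ (F t).image fun x => (p.link x).1
  have hT : ∀ t, (T t).card ≤ 2 * (F t).card := fun t => by
    have h1 : ((F t).image Prod.fst).card ≤ _ := Finset.card_image_le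
    have h2 : ((F t).image fun x => (p.link x).1).card ≤ _ := Finset.card_image_le
    have h3 : (T t).card ≤ _ := Finset.card_union_le _ _
    omega
  calc (n : ENNReal) = ∑ v : Fin n, 1 := by simp
    _ ≤ ∑ v : Fin n, ∑' t, (if v ∈ T t then 1 else 0) := by
      refine Finset.sum_le_sum fun v _ => ?_
      obtain ⟨t, x, hx, hv⟩ := exists_touched_of_not_silent (p := p) (h v)
      refine le_trans ?_ (ENNReal.le_tsum t)
      rw [if_pos]
      simp only [T, F, Finset.mem_union, Finset.mem_image, Finset.mem_filter, Finset.mem_univ,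
        true_and]
      exact hv.imp (fun hv => ⟨x, hx, hv⟩) fun hv => ⟨x, hx, hv⟩
    _ = ∑' t, ((T t).card : ENNReal) := by
      rw [← tsum_fintype (L := .unconditional _), ENNReal.tsum_comm]
      congr with t
      rw [tsum_fintype]
      simp
    _ ≤ ∑' t, 2 * ((F t).card : ENNReal) :=
      ENNReal.tsum_le_tsum fun t => by exact_mod_cast hT t
    _ = 2 * A.messages ids p ω := ENNReal.tsum_mul_left

theorem le_expectedMessages_of_silent_null (h : ∀ v, tapeLaw (A.silent (ids v)) = 0) :
    ENNReal.ofReal (1 / 2 * n) ≤ A.expectedMessages ids p := by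
  have hae : ∀ᵐ ω ∂(tapesLaw n), ∀ v, ω v ∉ A.silent (ids v) := by
    rw [ae_all_iff]
    intro v
    have hq : Measure.QuasiMeasurePreserving (Function.eval v) (tapesLaw n) tapeLaw :=
      (measurePreserving_eval (fun _ : Fin n => tapeLaw) v).quasiMeasurePreserving
    exact hq.ae (measure_eq_zero_iff_ae_notMem.1 (h v))
  calc ENNReal.ofReal (1 / 2 * n) = ∫⁻ _, ENNReal.ofReal (1 / 2 * n) ∂(tapesLaw n) := by simp
    _ ≤ A.expectedMessages ids p := by
      refine lintegral_mono_ae (hae.mono fun ω hω => ?_)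
      have h2 := card_le_two_mul_messages (p := p) hω
      have : ENNReal.ofReal (1 / 2 * n) = (n : ENNReal) / 2 := by
        rw [one_div, ENNReal.ofReal_mul (by norm_num), ENNReal.ofReal_natCast,
          ENNReal.ofReal_inv_of_pos (by norm_num), mul_comm, div_eq_mul_inv]
        norm_num
      rw [this]
      exact ENNReal.div_le_of_le_mul' h2

end Solo

/-! ### The lower bound for Las Vegas algorithms -/

variable {n : ℕ} {A : Algorithm n Bool} {U : Set ℤ}

/-- A product of events of positive probability meets the almost sure event of a correct election.
`Measure.pi_pi` holds for arbitrary sets, so the events need not be measurable. The port mapping is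
irrelevant, since nothing is sent. -/
theorem IsLasVegas.not_forall_mem (hA : A.IsLasVegas U ImplicitElection) {ids : Fin n ↪ ℤ}
    (hU : ∀ v, ids v ∈ U) {E : Fin n → Set Tape} (hE : ∀ v, tapeLaw (E v) ≠ 0)
    (hs : ∀ v, E v ⊆ A.silent (ids v)) :
    ∃ ω : Fin n → Tape, (∀ v, ω v ∈ E v) ∧
      ∃! v, ∃ t, A.soloOut (ids v) (ω v) t = some true := by
  have hpos : tapesLaw n (Set.univ.pi E) ≠ 0 := by
    rw [tapesLaw, Measure.pi_pi]
    exact Finset.prod_ne_zero_iff.2 fun v _ => hE v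
  obtain ⟨ω, hω, t, o, ho, v, hv, huniq⟩ :=
    ((frequently_ae_mem_iff.2 hpos).and_eventually (hA ids hU (cyclicPorts n))).exists
  have hω : ∀ v, ω v ∈ E v := fun v => hω v trivial
  have ho' : ∀ v, A.soloOut (ids v) (ω v) t = some (o v) := fun v => by
    rw [← output_eq_soloOut_of_silent (p := cyclicPorts n) (ids := ids) fun v => hs v (hω v), ho]
  refine ⟨ω, hω, v, ⟨t, by rw [ho', hv]⟩, ?_⟩
  rintro w ⟨t', ht'⟩
  apply huniq
  have h1 := A.soloOut_mono ht' (le_max_right t t')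
  rw [A.soloOut_mono (ho' w) (le_max_left t t')] at h1
  exact Option.some.inj h1

/-- Otherwise, discarding null sets leaves a positive probability that all nodes are silent and none
outputs `true`. -/
theorem IsLasVegas.exists_leading (hA : A.IsLasVegas U ImplicitElection) {W : Set ℤ} (hW : W ⊆ U)
    (hsil : ∀ x ∈ W, tapeLaw (A.silent x) ≠ 0) (hn : n ≤ W.encard) :
    ∃ x ∈ W, tapeLaw (A.silentOut x true) ≠ 0 := by
  by_contra! hc
  obtain ⟨ids, hids, -⟩ := exists_embedding_between (Set.empty_subset W) (by simp) hn
  obtain ⟨ω, hω, v, ⟨t, ht⟩, -⟩ := hA.not_forall_mem (fun v => hW (hids v))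
    (E := fun v => A.silent (ids v) \ A.silentOut (ids v) true)
    (fun v => by rw [measure_sdiff_null (hc _ (hids v))]; exact hsil _ (hids v))
    (fun v => Set.sdiff_subset)
  exact (hω v).2 ⟨(hω v).1, t, ht⟩

theorem IsLasVegas.exists_expectedMessages_ge (hn : 2 ≤ n) (hU : ((3 * n : ℕ) : ℕ∞) ≤ U.encard)
    (hA : A.IsLasVegas U ImplicitElection) :
    ∃ ids : Fin n ↪ ℤ, (∀ v, ids v ∈ U) ∧ ∃ p : PortMapping n,
      ENNReal.ofReal (1 / 2 * n) ≤ A.expectedMessages ids p := by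
  classical
  let V : Set ℤ := {x ∈ U | tapeLaw (A.silent x) = 0}
  let W : Set ℤ := {x ∈ U | tapeLaw (A.silent x) ≠ 0}
  have hWU : W ⊆ U := fun x hx => hx.1
  rcases le_or_gt (n : ℕ∞) V.encard with hV | hV
  · obtain ⟨ids, hids, -⟩ := exists_embedding_between (Set.empty_subset V) (by simp) hV
    exact ⟨ids, fun v => (hids v).1, cyclicPorts n,
      le_expectedMessages_of_silent_null fun v => (hids v).2⟩
  exfalso
  have hUVW : U = V ∪ W := by
    ext x; simp only [V, W, Set.mem_union, Set.mem_ofPred_eq]; tauto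
  -- One element beyond `n`, so that `n` IDs remain after `a` is removed.
  have hWc : ((n + 1 : ℕ) : ℕ∞) ≤ W.encard := by
    by_contra! hlt
    have h1 := hUVW ▸ Set.encard_union_le V W
    have h2 := hU.trans h1
    lift V.encard to ℕ using hV.ne_top with a
    lift W.encard to ℕ using hlt.ne_top with b
    norm_cast at *
    omega
  obtain ⟨a, ha, ha'⟩ := hA.exists_leading hWU (fun x hx => hx.2)
    (le_trans (by exact_mod_cast Nat.le_succ n) hWc)
  have hWa : (n : ℕ∞) ≤ (W \ {a}).encard := by
    have h1 := Set.encard_sdiff_singleton_add_one ha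
    rw [← h1] at hWc
    push_cast at hWc
    exact (ENat.add_le_add_iff_right (by simp)).1 hWc
  obtain ⟨b, hb, hb'⟩ := hA.exists_leading (Set.sdiff_subset.trans hWU) (fun x hx => hx.1.2) hWa
  have hab : b ≠ a := hb.2
  obtain ⟨ids, hids, hrange⟩ := exists_embedding_between (S := W) (T := {a, b}) (n := n)
    (by rintro x (rfl | rfl); exacts [ha, hb.1])
    (by rw [Set.encard_pair hab.symm]; exact_mod_cast hn)
    (le_trans (by exact_mod_cast Nat.le_succ n) hWc)
  obtain ⟨va, hva⟩ := hrange a (by simp)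
  obtain ⟨vb, hvb⟩ := hrange b (by simp)
  -- The nodes holding `a` and `b` are both made to elect themselves silently; all others are only
  -- required to be silent.
  obtain ⟨ω, hω, v, -, huniq⟩ := hA.not_forall_mem (fun v => (hids v).1)
    (E := fun v => if v = va ∨ v = vb then A.silentOut (ids v) true else A.silent (ids v))
    (fun v => by
      split_ifs with h
      · rcases h with rfl | rfl
        · rwa [hva]
        · rwa [hvb]
      · exact (hids v).2)
    (fun v => by
      split_ifs
      exacts [Set.inter_subset_left, subset_rfl])
  have h1 := huniq va (by have := hω va; simp only [true_or, if_true] at this; exact this.2)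
  have h2 := huniq vb (by have := hω vb; simp only [or_true, if_true] at this; exact this.2)
  exact hab (by rw [← hva, ← hvb, h1, h2])

end Algorithm

/-! ### Probabilities of coin flip patterns -/

section Bits

open ProbabilityTheory
open scoped ENNReal

theorem tapeLaw_forall_true (S : Finset ℕ) :
    tapeLaw {r | ∀ b ∈ S, r b = true} = 2⁻¹ ^ S.card := by
  have h : {r : Tape | ∀ b ∈ S, r b = true} = Set.pi S fun _ => {true} := by
    ext r; simp
  rw [h, tapeLaw, Measure.infinitePi_pi _ (fun _ _ => MeasurableSet.of_discrete)]
  simp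

variable {n : ℕ}

/-- The event that all coin flips at the positions in `D` show `true`. -/
def allTrue (D : Finset (Fin n × ℕ)) : Set (Fin n → Tape) :=
  {ω | ∀ x ∈ D, ω x.1 x.2 = true}

theorem measurableSet_allTrue (D : Finset (Fin n × ℕ)) : MeasurableSet (allTrue D) := by
  have h : allTrue D = ⋂ x ∈ D, {ω : Fin n → Tape | ω x.1 x.2 = true} := by
    ext ω; simp [allTrue]
  rw [h]
  refine Finset.measurableSet_biInter _ fun x _ => ?_
  have : Measurable fun ω : Fin n → Tape => ω x.1 x.2 := by fun_prop
  exact this (measurableSet_singleton true)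

theorem tapesLaw_allTrue (D : Finset (Fin n × ℕ)) :
    tapesLaw n (allTrue D) = 2⁻¹ ^ D.card := by
  -- Splitting the positions by node turns the event into a product over the tapes.
  let S : Fin n → Finset ℕ := fun v => (D.filter fun x => x.1 = v).image Prod.snd
  have hS : ∀ v, (S v).card = (D.filter fun x => x.1 = v).card := fun v => by
    refine Finset.card_image_of_injOn ?_
    rintro ⟨a, b⟩ h ⟨a', b'⟩ h' (hb : b = b')
    simp only [Finset.coe_filter, Set.mem_ofPred_eq] at h h'
    rw [hb, h.2, h'.2]
  have h : allTrue D = Set.univ.pi fun v => {r : Tape | ∀ b ∈ S v, r b = true} := by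
    ext ω
    simp only [allTrue, S, Set.mem_ofPred_eq, Set.mem_pi, Set.mem_univ, true_imp_iff,
      Finset.mem_image, Finset.mem_filter]
    constructor
    · rintro h v b ⟨⟨w, c⟩, ⟨hx, rfl⟩, rfl⟩
      exact h _ hx
    · rintro h ⟨v, b⟩ hx
      exact h v b ⟨(v, b), ⟨hx, rfl⟩, rfl⟩
  rw [h, tapesLaw, Measure.pi_pi]
  simp only [tapeLaw_forall_true, Finset.prod_pow_eq_pow_sum, hS]
  rw [← Finset.card_eq_sum_card_fiberwise (f := Prod.fst) (t := Finset.univ) (by simp)]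

variable {ι : Type*} {D : ι → Finset (Fin n × ℕ)} {d : ℕ}

theorem tapesLaw_biInter_allTrue (hD : Pairwise fun i j => Disjoint (D i) (D j))
    (hd : ∀ i, (D i).card = d) (s : Finset ι) :
    tapesLaw n (⋂ i ∈ s, allTrue (D i)) = (2⁻¹ ^ d) ^ s.card := by
  classical
  have h : (⋂ i ∈ s, allTrue (D i)) = allTrue (s.biUnion D) := by
    ext ω
    simp only [allTrue, Set.mem_iInter, Set.mem_ofPred_eq, Finset.mem_biUnion]
    exact ⟨fun h x ⟨i, hi, hx⟩ => h i hi x hx, fun h i hi x hx => h x ⟨i, hi, hx⟩⟩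
  rw [h, tapesLaw_allTrue, Finset.card_biUnion fun i _ j _ hij => hD hij]
  simp [hd, ← pow_mul, mul_comm]

theorem iIndepSet_allTrue (hD : Pairwise fun i j => Disjoint (D i) (D j))
    (hd : ∀ i, (D i).card = d) : iIndepSet (fun i => allTrue (D i)) (tapesLaw n) := by
  rw [iIndepSet_iff_meas_biInter fun i => measurableSet_allTrue _]
  intro s
  rw [tapesLaw_biInter_allTrue hD hd]
  simp [tapesLaw_allTrue, hd]

theorem tapesLaw_forall_notMem_allTrue [Fintype ι]
    (hD : Pairwise fun i j => Disjoint (D i) (D j)) (hd : ∀ i, (D i).card = d) :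
    tapesLaw n {ω | ∀ i, ω ∉ allTrue (D i)} = (1 - 2⁻¹ ^ d) ^ Fintype.card ι := by
  have h : {ω | ∀ i, ω ∉ allTrue (D i)} = ⋂ i, (allTrue (D i))ᶜ := by ext ω; simp
  rw [h, iIndep.meas_iInter (iIndepSet_allTrue hD hd) fun i =>
    (MeasurableSpace.measurableSet_generateFrom (Set.mem_singleton _)).compl]
  simp [prob_compl_eq_one_sub (measurableSet_allTrue _), tapesLaw_allTrue, hd]

open Classical in
-- Union bound over all `x`-element sets of events that occur together.
theorem tapesLaw_le_card_allTrue_le [Fintype ι]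
    (hD : Pairwise fun i j => Disjoint (D i) (D j)) (hd : ∀ i, (D i).card = d) (x : ℕ) :
    tapesLaw n {ω | x ≤ (Finset.univ.filter fun i => ω ∈ allTrue (D i)).card} ≤
      (Fintype.card ι).choose x * (2⁻¹ ^ d) ^ x := by
  have h : {ω | x ≤ (Finset.univ.filter fun i => ω ∈ allTrue (D i)).card} ⊆
      ⋃ s ∈ (Finset.univ : Finset ι).powersetCard x, ⋂ i ∈ s, allTrue (D i) := by
    intro ω hω
    obtain ⟨s, hs, hx⟩ := Finset.exists_subset_card_eq hω
    simp only [Set.mem_iUnion, Set.mem_iInter, Finset.mem_powersetCard]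
    exact ⟨s, ⟨Finset.subset_univ _, hx⟩, fun i hi => (Finset.mem_filter.1 (hs hi)).2⟩
  refine (measure_mono h).trans ((measure_biUnion_finset_le _ _).trans ?_)
  rw [Finset.sum_congr rfl fun s hs => by
    rw [tapesLaw_biInter_allTrue hD hd, (Finset.mem_powersetCard.1 hs).2]]
  simp

theorem one_sub_inv_pow_le_exp (d m : ℕ) :
    ((1 - 2⁻¹ ^ d) ^ m : ℝ≥0∞) ≤ ENNReal.ofReal (Real.exp (-(m / 2 ^ d))) := by
  have h0 : (2⁻¹ ^ d : ℝ) ≤ 1 := pow_le_one₀ (by norm_num) (by norm_num)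
  have h1 : (1 - 2⁻¹ ^ d : ℝ≥0∞) = ENNReal.ofReal (1 - 2⁻¹ ^ d) := by
    rw [ENNReal.ofReal_sub _ (by positivity), ENNReal.ofReal_pow (by norm_num),
      ENNReal.ofReal_inv_of_pos (by norm_num)]
    simp
  rw [h1, ← ENNReal.ofReal_pow (by linarith)]
  refine ENNReal.ofReal_le_ofReal ?_
  calc (1 - 2⁻¹ ^ d : ℝ) ^ m ≤ Real.exp (-2⁻¹ ^ d) ^ m :=
        pow_le_pow_left₀ (by linarith) (Real.one_sub_le_exp_neg _) m
    _ = _ := by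
        rw [← Real.exp_nat_mul]
        congr 1
        rw [inv_pow]; ring

/-- With `y = m / 2 ^ d` the left side is at most `y ^ x / x!`, which equals `(e y) ^ x / x! * exp
(-x)`; one term of the exponential series is at most `exp (e y)`, and `e < 3`. -/
theorem choose_mul_inv_pow_le_exp (d m x : ℕ) :
    (m.choose x * (2⁻¹ ^ d) ^ x : ℝ≥0∞) ≤ ENNReal.ofReal (Real.exp (3 * (m / 2 ^ d) - x)) := by
  have h1 : (m.choose x * (2⁻¹ ^ d) ^ x : ℝ≥0∞) =
      ENNReal.ofReal (m.choose x * (2⁻¹ ^ d) ^ x) := by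
    rw [ENNReal.ofReal_mul (by positivity), ENNReal.ofReal_pow (by positivity),
      ENNReal.ofReal_pow (by positivity), ENNReal.ofReal_inv_of_pos (by norm_num)]
    simp
  rw [h1]
  refine ENNReal.ofReal_le_ofReal ?_
  have h2 : (m.choose x : ℝ) ≤ m ^ x / x.factorial := Nat.choose_le_pow_div x m
  have h3 := Real.pow_div_factorial_le_exp (x := Real.exp 1 * (m / 2 ^ d)) (by positivity) x
  have h4 : Real.exp 1 * (m / 2 ^ d) ≤ 3 * (m / 2 ^ d) :=
    mul_le_mul_of_nonneg_right Real.exp_one_lt_three.le (by positivity)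
  calc (m.choose x * (2⁻¹ ^ d) ^ x : ℝ) ≤ m ^ x / x.factorial * (2⁻¹ ^ d) ^ x := by gcongr
    _ = (Real.exp 1 * (m / 2 ^ d)) ^ x / x.factorial * Real.exp (-x) := by
        have : Real.exp 1 ^ x * Real.exp (-x) = 1 := by
          rw [← Real.exp_nat_mul, ← Real.exp_add]; simp
        rw [mul_pow, div_pow, inv_pow, inv_pow, div_mul_eq_mul_div, div_mul_eq_mul_div,
          mul_right_comm, this]
        ring
    _ ≤ Real.exp (3 * (m / 2 ^ d)) * Real.exp (-x) := by
        gcongr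
        exact h3.trans (Real.exp_le_exp.2 h4)
    _ = _ := by rw [← Real.exp_add]; rfl

end Bits

/-! ### IDs as messages -/

/-- Sign and magnitude encoding of an integer. -/
def encodeInt (z : ℤ) : Msg := decide (z < 0) :: z.natAbs.bits

theorem length_encodeInt (z : ℤ) : (encodeInt z).length = z.natAbs.size + 1 := by
  simp [encodeInt, Nat.size_eq_bits_len]

theorem encodeInt_injective : Function.Injective encodeInt := by
  intro a b h
  obtain ⟨h1, h2⟩ := List.cons.inj h
  have h3 : a.natAbs = b.natAbs := by
    refine Nat.eq_of_testBit_eq fun i => ?_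
    rw [Nat.testBit_eq_inth, Nat.testBit_eq_inth, h2]
  have h4 : a < 0 ↔ b < 0 := by simpa using h1
  omega

/-- The integer encoded by a message. -/
noncomputable def decodeInt : Msg → ℤ := Function.invFun encodeInt

@[simp]
theorem decodeInt_encodeInt (z : ℤ) : decodeInt (encodeInt z) = z :=
  Function.leftInverse_invFun encodeInt_injective z

/-- The IDs announced in an inbox. -/
noncomputable def heard {n : ℕ} (b : Inbox n) : Finset ℤ :=
  Finset.univ.biUnion fun i => (b i).toFinset.image decodeInt

theorem mem_heard {n : ℕ} {b : Inbox n} {x : ℤ} :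
    x ∈ heard b ↔ ∃ i, ∃ m, b i = some m ∧ decodeInt m = x := by
  simp [heard]

/-- The greatest element of a finite set, if there is one. -/
noncomputable def maxOpt (S : Finset ℤ) : Option ℤ :=
  if h : S.Nonempty then some (S.max' h) else none

theorem maxOpt_empty : maxOpt ∅ = none := by simp [maxOpt]

theorem exists_maxOpt_image {α : Type*} {f : α → ℤ} {S : Finset α} (h : S.Nonempty) :
    ∃ a ∈ S, maxOpt (S.image f) = some (f a) := by
  have h' : (S.image f).Nonempty := h.image f
  obtain ⟨a, ha, hm⟩ := Finset.mem_image.1 ((S.image f).max'_mem h')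
  exact ⟨a, ha, by rw [maxOpt, dif_pos h', hm]⟩

/-- The rules of the election consult the tape only to choose between two fixed values. -/
theorem measurableSet_ite_eq {α β : Type*} [MeasurableSpace α] {q : α → Prop} [DecidablePred q]
    (hq : MeasurableSet {r | q r}) (a b c : β) :
    MeasurableSet {r | (if q r then a else b) = c} := by
  by_cases ha : a = c <;> by_cases hb : b = c
  · convert MeasurableSet.univ (α := α) using 1
    ext r; simp [ha, hb]
  · convert hq using 1
    ext r; simp only [Set.mem_ofPred_eq]; split_ifs with h <;> simp [h, ha, hb]
  · convert hq.compl using 1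
    ext r; simp only [Set.mem_ofPred_eq, Set.mem_compl_iff]; split_ifs with h <;> simp [h, ha, hb]
  · convert MeasurableSet.empty (α := α) using 1
    ext r
    simp only [Set.mem_ofPred_eq, Set.mem_empty_iff_false, iff_false]
    split_ifs <;> assumption

namespace PortMapping

variable {n : ℕ} (p : PortMapping n)

theorem link_injective : Function.Injective p.link :=
  Function.LeftInverse.injective p.link_link

/-- The `n - 1` ports lead injectively to the `n - 1` other nodes. -/
theorem exists_port {u v : Fin n} (h : v ≠ u) : ∃ i, (p.link (u, i)).1 = v := by
  let f : Fin (n - 1) → {v // v ≠ u} := fun i => ⟨(p.link (u, i)).1, p.link_ne (u, i)⟩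
  have hf : Function.Injective f := fun i j hij => p.link_inj u i j (Subtype.ext_iff.1 hij)
  have hb := (Fintype.bijective_iff_injective_and_card f).2 ⟨hf, by
    simp [Fintype.card_subtype_compl]⟩
  obtain ⟨i, hi⟩ := hb.2 ⟨v, h⟩
  exact ⟨i, Subtype.ext_iff.1 hi⟩

end PortMapping

/-! ### The election with referees -/

/-- The rules for choosing candidates and the referees of a candidate. -/
structure Lottery where
  cand : Set Tape
  coin : ℕ → Set Tape
  measurableSet_cand : MeasurableSet cand
  measurableSet_coin : ∀ i, MeasurableSet (coin i)

open Classical in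
/-- Explicit election with referees. Round 1: the candidates send their IDs to random referees.
Round 2: the referees inform the candidates that are not the best ones they know. Round 3: the
candidates that have not been informed announce themselves to all nodes. Only if there is no
announcement, all nodes announce themselves in round 4. -/
noncomputable def refereeElection (n : ℕ) (l : Lottery) : Algorithm n ℤ where
  decide id r
    | [b₃, b₂, _] =>
      -- An announcing node does not hear itself, so its own ID is inserted. Without announcements
      -- `maxOpt` yields `none` and the node continues.
      if r ∈ l.cand ∧ ∀ j, b₂ j = none then maxOpt (insert id (heard b₃)) else maxOpt (heard b₃)
    | [b₄, _, _, _] => maxOpt (insert id (heard b₄))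
    | _ => none
  send id r h i :=
    match h with
    | [] => if r ∈ l.cand ∧ r ∈ l.coin i then some (encodeInt id) else none
    | [b₁] =>
      -- The empty string suffices as a veto: only the arrival of a message counts.
      if ∃ j m m', b₁ i = some m ∧ b₁ j = some m' ∧ decodeInt m < decodeInt m' then some []
      else none
    | [b₂, _] => if r ∈ l.cand ∧ ∀ j, b₂ j = none then some (encodeInt id) else none
    | [_, _, _] => some (encodeInt id)
    | _ => none
  measurable_decide := by
    intro id h o
    split
    · exact measurableSet_ite_eq (q := fun r => r ∈ l.cand ∧ _)
        (l.measurableSet_cand.inter (.const _)) _ _ _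
    · exact .const _
    · exact .const _
  measurable_send := by
    intro id h i m
    split
    · exact measurableSet_ite_eq (q := fun r => r ∈ l.cand ∧ r ∈ l.coin i)
        (l.measurableSet_cand.inter (l.measurableSet_coin i)) _ _ _
    · exact .const _
    · exact measurableSet_ite_eq (q := fun r => r ∈ l.cand ∧ _)
        (l.measurableSet_cand.inter (.const _)) _ _ _
    · exact .const _
    · exact .const _

namespace Algorithm

variable {n : ℕ} {Out : Type} {A : Algorithm n Out} {ids : Fin n → ℤ} {p : PortMapping n}
  {ω : Fin n → Tape}

theorem output_mono {v : Fin n} {t t' : ℕ} {o : Out} (h : A.output ids p ω t v = some o)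
    (ht : t ≤ t') : A.output ids p ω t' v = some o := by
  induction t', ht using Nat.le_induction with
  | base => exact h
  | succ t' _ ih =>
    change (A.state ids p ω t' v).out = some o at ih
    change ((A.state ids p ω t' v).out.or _) = some o
    simp [ih]

theorem sent_eq_none_of_output {v : Fin n} {t : ℕ} {o : Out} (h : A.output ids p ω t v = some o)
    (i : Fin (n - 1)) : A.sent ids p ω t v i = none := by
  change (A.state ids p ω t v).out = some o at h
  simp [sent, emit, h]

theorem sent_eq_send_of_output {v : Fin n} {t : ℕ} (h : A.output ids p ω t v = none)
    (i : Fin (n - 1)) :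
    A.sent ids p ω t v i = A.send (ids v) (ω v) (A.state ids p ω t v).hist i := by
  change (A.state ids p ω t v).out = none at h
  simp [sent, emit, h]

/-- The messages that `v` receives in round `t + 1`. -/
def inbox (A : Algorithm n Out) (ids : Fin n → ℤ) (p : PortMapping n) (ω : Fin n → Tape)
    (t : ℕ) (v : Fin n) : Inbox n :=
  fun i => A.sent ids p ω t (p.link (v, i)).1 (p.link (v, i)).2

theorem heard_inbox {t : ℕ} {Q : Fin n → Prop} [DecidablePred Q]
    (h : ∀ w i, A.sent ids p ω t w i = if Q w then some (encodeInt (ids w)) else none) (v : Fin n) :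
    heard (A.inbox ids p ω t v) = (Finset.univ.filter fun w => w ≠ v ∧ Q w).image ids := by
  ext x
  simp only [mem_heard, inbox, h, Finset.mem_image, Finset.mem_filter, Finset.mem_univ, true_and]
  constructor
  · rintro ⟨i, m, hm, rfl⟩
    split_ifs at hm with hq
    obtain rfl := Option.some.inj hm
    exact ⟨_, ⟨p.link_ne (v, i), hq⟩, by simp⟩
  · rintro ⟨w, ⟨hw, hq⟩, rfl⟩
    obtain ⟨i, hi⟩ := p.exists_port hw
    exact ⟨i, encodeInt (ids w), by rw [if_pos (by rwa [hi]), hi], by simp⟩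

end Algorithm

/-! ### Correctness and message count for an arbitrary lottery -/

namespace refereeElection

open Algorithm

variable {n : ℕ} {l : Lottery}

theorem length_le_of_send {id : ℤ} {r : Tape} {h : List (Inbox n)} {i : Fin (n - 1)} {m : Msg}
    (hm : (refereeElection n l).send id r h i = some m) : m.length ≤ id.natAbs.size + 1 := by
  simp only [refereeElection] at hm
  have key : m = encodeInt id ∨ m = [] := by
    split at hm <;> (try split_ifs at hm) <;> simp_all
  rcases key with rfl | rfl
  · exact (length_encodeInt id).le
  · simp

variable {ids : Fin n → ℤ} {p : PortMapping n} {ω : Fin n → Tape}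

theorem length_le_of_sent {t : ℕ} {v : Fin n} {i : Fin (n - 1)} {m : Msg}
    (hm : (refereeElection n l).sent ids p ω t v i = some m) :
    m.length ≤ (ids v).natAbs.size + 1 := by
  cases ho : (refereeElection n l).output ids p ω t v with
  | some o => rw [sent_eq_none_of_output ho] at hm; cases hm
  | none => rw [sent_eq_send_of_output ho] at hm; exact length_le_of_send hm

variable (l ids p ω)

/-- The candidates that announce themselves in round 3. -/
def Announces (v : Fin n) : Prop :=
  ω v ∈ l.cand ∧ ∀ j, (refereeElection n l).inbox ids p ω 1 v j = none

open Classical in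
theorem sent_zero (v : Fin n) (i : Fin (n - 1)) : (refereeElection n l).sent ids p ω 0 v i =
    if ω v ∈ l.cand ∧ ω v ∈ l.coin i then some (encodeInt (ids v)) else none := rfl

open Classical in
theorem sent_one (v : Fin n) (i : Fin (n - 1)) : (refereeElection n l).sent ids p ω 1 v i =
    if ∃ j m m', (refereeElection n l).inbox ids p ω 0 v i = some m ∧
      (refereeElection n l).inbox ids p ω 0 v j = some m' ∧ decodeInt m < decodeInt m'
    then some [] else none := rfl

open Classical in
theorem sent_two (v : Fin n) (i : Fin (n - 1)) : (refereeElection n l).sent ids p ω 2 v i =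
    if Announces l ids p ω v then some (encodeInt (ids v)) else none := by
  have h : (refereeElection n l).sent ids p ω 2 v i =
    if ω v ∈ l.cand ∧ ∀ j, (refereeElection n l).inbox ids p ω 1 v j = none
    then some (encodeInt (ids v)) else none := rfl
  rw [h]
  exact if_congr Iff.rfl rfl rfl

open Classical in
-- The right side does not depend on `v`; this is the agreement of all nodes.
theorem output_three (v : Fin n) : (refereeElection n l).output ids p ω 3 v =
    maxOpt ((Finset.univ.filter (Announces l ids p ω)).image ids) := by
  have h1 : (refereeElection n l).output ids p ω 3 v =
      if ω v ∈ l.cand ∧ ∀ j, (refereeElection n l).inbox ids p ω 1 v j = none then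
        maxOpt (insert (ids v) (heard ((refereeElection n l).inbox ids p ω 2 v)))
      else maxOpt (heard ((refereeElection n l).inbox ids p ω 2 v)) := rfl
  rw [h1, heard_inbox (sent_two l ids p ω)]
  split_ifs with h
  · have h : Announces l ids p ω v := h
    rw [← Finset.image_insert]
    congr 2
    ext w
    by_cases hw : w = v <;> simp [hw, h]
  · have h : ¬ Announces l ids p ω v := h
    congr 2
    ext w
    by_cases hw : w = v <;> simp [hw, h]

theorem output_four (hA : ∀ v, ¬ Announces l ids p ω v) (v : Fin n) :
    (refereeElection n l).output ids p ω 4 v = maxOpt (Finset.univ.image ids) := by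
  classical
  have h3 : ∀ v, (refereeElection n l).output ids p ω 3 v = none := fun v => by
    rw [output_three, Finset.filter_false_of_mem fun v _ => hA v, Finset.image_empty, maxOpt_empty]
  have hs : ∀ w i, (refereeElection n l).sent ids p ω 3 w i =
      if True then some (encodeInt (ids w)) else none := fun w i => by
    rw [sent_eq_send_of_output (h3 w), if_pos trivial]; rfl
  have h1 : (refereeElection n l).output ids p ω 4 v =
      ((refereeElection n l).output ids p ω 3 v).or
        (maxOpt (insert (ids v) (heard ((refereeElection n l).inbox ids p ω 3 v)))) := rfl
  rw [h1, h3, heard_inbox hs, Option.none_or, ← Finset.image_insert]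
  congr 2
  ext w
  by_cases hw : w = v <;> simp [hw]

/-- Holds for every tape: all nodes output the greatest announced ID after round 3, or, without
announcements, the greatest ID after round 4. -/
theorem isLasVegas (hn : 1 ≤ n) : (refereeElection n l).IsLasVegas Set.univ ExplicitElection := by
  classical
  intro ids _ p
  refine Filter.Eventually.of_forall fun ω => ?_
  by_cases hA : ∃ v, Announces l ids p ω v
  · obtain ⟨v₀, hv₀⟩ := hA
    obtain ⟨a, -, ha⟩ := exists_maxOpt_image (f := ids)
      (S := Finset.univ.filter (Announces l ids p ω)) ⟨v₀, by simpa using hv₀⟩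
    exact ⟨3, fun _ => ids a, fun v => by rw [output_three, ha], a, fun _ => rfl⟩
  · push Not at hA
    obtain ⟨a, -, ha⟩ := exists_maxOpt_image (f := ids)
      (S := Finset.univ) ⟨⟨0, hn⟩, Finset.mem_univ _⟩
    exact ⟨4, fun _ => ids a, fun v => by rw [output_four _ _ _ _ hA, ha], a, fun _ => rfl⟩

variable {l ids p ω}

theorem inbox_zero_eq_some {v : Fin n} {i : Fin (n - 1)} {m : Msg}
    (h : (refereeElection n l).inbox ids p ω 0 v i = some m) :
    ω (p.link (v, i)).1 ∈ l.cand ∧ m = encodeInt (ids (p.link (v, i)).1) := by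
  classical
  rw [inbox, sent_zero] at h
  split_ifs at h with hc
  exact ⟨hc.1, (Option.some.inj h).symm⟩

/-- No referee knows a candidate better than the one with the greatest ID, so that one is never
vetoed. -/
theorem exists_announces (h : ∃ v, ω v ∈ l.cand) : ∃ v, Announces l ids p ω v := by
  classical
  obtain ⟨v₀, hv₀⟩ := h
  obtain ⟨v, hv, hmax⟩ := Finset.exists_max_image (Finset.univ.filter fun v => ω v ∈ l.cand) ids
    ⟨v₀, by simpa using hv₀⟩
  simp only [Finset.mem_filter, Finset.mem_univ, true_and] at hv hmax
  refine ⟨v, hv, fun j => ?_⟩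
  rw [inbox, sent_one, if_neg]
  rintro ⟨k, m, m', hm, hm', hlt⟩
  obtain ⟨-, rfl⟩ := inbox_zero_eq_some hm
  obtain ⟨hc, rfl⟩ := inbox_zero_eq_some hm'
  rw [Prod.mk.eta, p.link_link] at hlt
  simp only [decodeInt_encodeInt] at hlt
  exact absurd (hmax _ hc) (not_le.2 hlt)

theorem isSome_output_three (h : ∃ v, ω v ∈ l.cand) (v : Fin n) :
    ((refereeElection n l).output ids p ω 3 v).isSome = true := by
  classical
  obtain ⟨v₀, hv₀⟩ := exists_announces (ids := ids) (p := p) h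
  obtain ⟨a, -, ha⟩ := exists_maxOpt_image (f := ids)
    (S := Finset.univ.filter (Announces l ids p ω)) ⟨v₀, by simpa using hv₀⟩
  rw [output_three, ha]; rfl

/-- The nodes `u` and `v` have a common referee, provided that both of them are candidates. -/
def HaveReferee (l : Lottery) (p : PortMapping n) (ω : Fin n → Tape) (u v : Fin n) : Prop :=
  ∃ i j, (p.link (u, i)).1 = (p.link (v, j)).1 ∧ ω u ∈ l.coin i ∧ ω v ∈ l.coin j

/-- The common referee receives both IDs and vetoes the smaller one. -/
theorem not_announces_of_lt {u v : Fin n} (hu : ω u ∈ l.cand) (hv : ω v ∈ l.cand)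
    (hr : HaveReferee l p ω u v) (hlt : ids u < ids v) : ¬ Announces l ids p ω u := by
  classical
  obtain ⟨i, j, hij, hi, hj⟩ := hr
  intro hA
  have h1 := hA.2 i
  rw [inbox, sent_one, if_pos] at h1
  · cases h1
  refine ⟨(p.link (v, j)).2, encodeInt (ids u), encodeInt (ids v), ?_, ?_, by simpa using hlt⟩
  · rw [inbox, Prod.mk.eta, p.link_link, sent_zero, if_pos ⟨hu, hi⟩]
  · rw [inbox, hij, Prod.mk.eta, p.link_link, sent_zero, if_pos ⟨hv, hj⟩]

open Classical in
theorem card_announces_le_one (hids : Function.Injective ids)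
    (hr : ∀ u v, u ≠ v → HaveReferee l p ω u v) :
    (Finset.univ.filter (Announces l ids p ω)).card ≤ 1 := by
  refine Finset.card_le_one.2 fun u hu v hv => ?_
  simp only [Finset.mem_filter, Finset.mem_univ, true_and] at hu hv
  by_contra hne
  rcases lt_or_gt_of_ne (hids.ne hne) with h | h
  · exact not_announces_of_lt hu.1 hv.1 (hr u v hne) h hu
  · exact not_announces_of_lt hv.1 hu.1 (hr v u (Ne.symm hne)) h hv

open Classical in
theorem messages_le (h : ∃ v, ω v ∈ l.cand) :
    (refereeElection n l).messages ids p ω ≤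
      ((2 * (Finset.univ.filter fun x : Fin n × Fin (n - 1) =>
          ω x.1 ∈ l.cand ∧ ω x.1 ∈ l.coin x.2).card +
        (Finset.univ.filter (Announces l ids p ω)).card * (n - 1) : ℕ) : ENNReal) := by
  rw [messages, tsum_eq_sum (s := Finset.range 3)]
  · rw [← Nat.cast_sum]
    refine Nat.cast_le.2 ?_
    simp only [Finset.sum_range_succ, Finset.sum_range_zero, zero_add]
    have h0 : (Finset.univ.filter fun x : Fin n × Fin (n - 1) =>
        ((refereeElection n l).sent ids p ω 0 x.1 x.2).isSome = true) =
        Finset.univ.filter fun x : Fin n × Fin (n - 1) =>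
          ω x.1 ∈ l.cand ∧ ω x.1 ∈ l.coin x.2 := by
      ext x
      simp only [Finset.mem_filter, Finset.mem_univ, true_and]
      rw [sent_zero]
      split_ifs with hx <;> simp [hx]
    have h1 : (Finset.univ.filter fun x : Fin n × Fin (n - 1) =>
        ((refereeElection n l).sent ids p ω 1 x.1 x.2).isSome = true).card ≤
        (Finset.univ.filter fun x : Fin n × Fin (n - 1) =>
          ((refereeElection n l).sent ids p ω 0 x.1 x.2).isSome = true).card := by
      -- Each veto travels back over the link of a round 1 message, so vetoes inject into those
      -- messages.
      refine Finset.card_le_card_of_injOn p.link ?_ p.link_injective.injOn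
      intro x hx
      simp only [Finset.coe_filter, Finset.mem_univ, true_and, Set.mem_ofPred_eq] at hx ⊢
      rw [sent_one] at hx
      split_ifs at hx with hc
      · obtain ⟨j, m, m', hm, -⟩ := hc
        change (refereeElection n l).sent ids p ω 0 (p.link x).1 (p.link x).2 = some m at hm
        rw [hm]; rfl
      · cases hx
    have h2 : (Finset.univ.filter fun x : Fin n × Fin (n - 1) =>
        ((refereeElection n l).sent ids p ω 2 x.1 x.2).isSome = true) =
        (Finset.univ.filter (Announces l ids p ω)) ×ˢ Finset.univ := by
      ext x
      simp only [sent_two, Finset.mem_filter, Finset.mem_univ, true_and, Finset.mem_product,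
        and_true]
      split_ifs with hx <;> simp [hx]
    rw [h2, Finset.card_product, Finset.card_univ, Fintype.card_fin]
    rw [h0] at h1 ⊢
    omega
  -- With a candidate present, all nodes have terminated after round 3.
  · intro t ht
    have ht : 3 ≤ t := by simpa using ht
    simp only [Nat.cast_eq_zero, Finset.card_eq_zero, Finset.filter_eq_empty_iff, Finset.mem_univ,
      true_imp_iff]
    intro x
    obtain ⟨o, ho⟩ := Option.isSome_iff_exists.1 (isSome_output_three (ids := ids) (p := p) h x.1)
    rw [sent_eq_none_of_output (output_mono ho ht)]
    simp

end refereeElection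

/-! ### The lottery from coin flips, and its good event -/

open scoped ENNReal

variable {n : ℕ}

/-- The positions of the first `m` coin flips of block `j` on the tape of `v`. -/
def block (v : Fin n) (j m : ℕ) : Finset (Fin n × ℕ) :=
  (Finset.range m).image fun b => (v, Nat.pair j b)

theorem card_block (v : Fin n) (j m : ℕ) : (block v j m).card = m := by
  rw [block, Finset.card_image_of_injective, Finset.card_range]
  intro b b' h
  simpa using h

theorem disjoint_block {v w : Fin n} {i j m m' : ℕ} (h : v ≠ w ∨ i ≠ j) :
    Disjoint (block v i m) (block w j m') := by
  rw [Finset.disjoint_left]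
  intro x hx hx'
  simp only [block, Finset.mem_image, Finset.mem_range] at hx hx'
  obtain ⟨b, -, rfl⟩ := hx
  obtain ⟨b', -, hb⟩ := hx'
  simp only [Prod.mk.injEq, Nat.pair_eq_pair] at hb
  rcases h with h | h
  · exact h hb.1.symm
  · exact h hb.2.1.symm

theorem mem_allTrue_block {ω : Fin n → Tape} {v : Fin n} {j m : ℕ} :
    ω ∈ allTrue (block v j m) ↔ ∀ b < m, ω v (Nat.pair j b) = true := by
  simp [allTrue, block]

theorem measurableSet_forall_lt_true (j m : ℕ) :
    MeasurableSet {r : Tape | ∀ b < m, r (Nat.pair j b) = true} := by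
  simp only [Set.ofPred_forall]
  refine MeasurableSet.iInter fun b => MeasurableSet.iInter fun _ => ?_
  have h : Measurable fun r : Tape => r (Nat.pair j b) := by fun_prop
  exact h (measurableSet_singleton true)

/-- A node is a candidate with probability `4⁻¹ ^ s`, and each port of a candidate leads to a referee
with probability `2⁻¹ ^ s`. -/
def bitLottery (s : ℕ) : Lottery where
  cand := {r | ∀ b < 2 * s, r (Nat.pair 0 b) = true}
  -- The shift keeps block 0 for candidacy, so the flips used are disjoint.
  coin i := {r | ∀ b < s, r (Nat.pair (i + 1) b) = true}
  measurableSet_cand := measurableSet_forall_lt_true _ _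
  measurableSet_coin _ := measurableSet_forall_lt_true _ _

/-- All nodes are candidates, and there are no referees. -/
def fullLottery : Lottery where
  cand := Set.univ
  coin _ := ∅
  measurableSet_cand := .univ
  measurableSet_coin _ := .empty

namespace bitLottery

open refereeElection

theorem mem_cand {s : ℕ} {ω : Fin n → Tape} {v : Fin n} :
    ω v ∈ (bitLottery s).cand ↔ ω ∈ allTrue (block v 0 (2 * s)) := mem_allTrue_block.symm

theorem mem_coin {s i : ℕ} {ω : Fin n → Tape} {v : Fin n} :
    ω v ∈ (bitLottery s).coin i ↔ ω ∈ allTrue (block v (i + 1) s) := mem_allTrue_block.symm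

theorem pairwise_disjoint_cand (m : ℕ) :
    Pairwise fun v w : Fin n => Disjoint (block v 0 m) (block w 0 m) :=
  fun _ _ h => disjoint_block (Or.inl h)

variable {s : ℕ}

/-- The expected number of candidates is `n / 4 ^ s ≥ 2 ^ s`. The extra 2 in the exponent only
matches the bound for missing referees. -/
theorem measure_no_cand_le (h₁ : 8 ^ s ≤ n) :
    tapesLaw n {ω | ∀ v, ω v ∉ (bitLottery s).cand} ≤ ENNReal.ofReal (Real.exp (2 - 2 ^ s)) := by
  simp only [mem_cand]
  rw [tapesLaw_forall_notMem_allTrue (pairwise_disjoint_cand _) fun v => card_block v 0 (2 * s)]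
  refine (one_sub_inv_pow_le_exp _ _).trans (ENNReal.ofReal_le_ofReal (Real.exp_le_exp.2 ?_))
  have h : (2 : ℝ) ^ s * 2 ^ (2 * s) ≤ n := by
    rw [← pow_add, show s + 2 * s = 3 * s by ring, pow_mul]
    exact_mod_cast h₁
  have := (le_div_iff₀ (by positivity)).2 h
  rw [Fintype.card_fin]
  linarith

open Classical in
-- The expectation is at most `8 * 2 ^ s`, and the threshold 64 exceeds `3 * 8` by enough for the
-- exponential tail.
theorem measure_many_cand_le (h₂ : n ≤ 8 * 8 ^ s) :
    tapesLaw n {ω | 64 * 2 ^ s ≤ (Finset.univ.filter fun v => ω v ∈ (bitLottery s).cand).card} ≤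
      ENNReal.ofReal (Real.exp (2 - 2 ^ s)) := by
  simp only [mem_cand]
  refine (tapesLaw_le_card_allTrue_le (pairwise_disjoint_cand _)
    (fun v => card_block v 0 (2 * s)) _).trans ((choose_mul_inv_pow_le_exp _ _ _).trans
    (ENNReal.ofReal_le_ofReal (Real.exp_le_exp.2 ?_)))
  have h : (n : ℝ) ≤ (8 * 2 ^ s) * 2 ^ (2 * s) := by
    rw [mul_assoc, ← pow_add, show s + 2 * s = 3 * s by ring, pow_mul]
    norm_num
    exact_mod_cast h₂
  have := (div_le_iff₀ (by positivity)).2 h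
  have hpos : (0 : ℝ) < 2 ^ s := by positivity
  rw [Fintype.card_fin]
  push_cast
  linarith

open Classical in
theorem measure_many_coins_le (h₂ : n ≤ 8 * 8 ^ s) (v : Fin n) :
    tapesLaw n {ω | 64 * 4 ^ s ≤ (Finset.univ.filter fun i : Fin (n - 1) =>
      ω v ∈ (bitLottery s).coin i).card} ≤ ENNReal.ofReal (Real.exp (2 - 2 ^ s)) := by
  simp only [mem_coin]
  refine (tapesLaw_le_card_allTrue_le (D := fun i : Fin (n - 1) => block v (i + 1) s)
    (fun i j h => disjoint_block (Or.inr (by simpa [Fin.val_inj] using h)))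
    (fun i => card_block v (i + 1) s) _).trans ((choose_mul_inv_pow_le_exp _ _ _).trans
    (ENNReal.ofReal_le_ofReal (Real.exp_le_exp.2 ?_)))
  have h : ((n - 1 : ℕ) : ℝ) ≤ (8 * 4 ^ s) * 2 ^ s := by
    rw [mul_assoc, ← mul_pow]
    norm_num
    exact_mod_cast (Nat.sub_le n 1).trans h₂
  have := (div_le_iff₀ (by positivity)).2 h
  have hle : (2 : ℝ) ^ s ≤ 4 ^ s := by gcongr; norm_num
  have hpos : (0 : ℝ) < 2 ^ s := by positivity
  rw [Fintype.card_fin]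
  push_cast
  linarith

/-- Each of the `n - 2` other nodes is a common referee independently with probability `4⁻¹ ^ s`,
and `(n - 2) / 4 ^ s ≥ 2 ^ s - 2`. Candidacy plays no role, so nothing has to be conditioned on it.
-/
theorem measure_no_referee_le (h₁ : 8 ^ s ≤ n) (p : PortMapping n) {u v : Fin n} (huv : u ≠ v) :
    tapesLaw n {ω | ¬ HaveReferee (bitLottery s) p ω u v} ≤
      ENNReal.ofReal (Real.exp (2 - 2 ^ s)) := by
  classical
  let ι := {w : Fin n // w ∉ ({u, v} : Finset (Fin n))}
  have hι : Fintype.card ι = n - 2 := by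
    rw [Fintype.card_subtype_compl, Fintype.card_coe, Finset.card_pair huv, Fintype.card_fin]
  have hw : ∀ w : ι, w.1 ≠ u ∧ w.1 ≠ v := fun w => by simpa using w.2
  choose f hf using fun w : ι => p.exists_port (hw w).1
  choose g hg using fun w : ι => p.exists_port (hw w).2
  have hf' : ∀ {w w'}, w ≠ w' → (f w : ℕ) + 1 ≠ f w' + 1 := fun {w w'} hne h => hne <| by
    have h : f w = f w' := Fin.ext (by omega)
    exact Subtype.ext (by rw [← hf w, ← hf w', h])
  have hg' : ∀ {w w'}, w ≠ w' → (g w : ℕ) + 1 ≠ g w' + 1 := fun {w w'} hne h => hne <| by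
    have h : g w = g w' := Fin.ext (by omega)
    exact Subtype.ext (by rw [← hg w, ← hg w', h])
  let D : ι → Finset (Fin n × ℕ) := fun w => block u (f w + 1) s ∪ block v (g w + 1) s
  have hD : Pairwise fun w w' => Disjoint (D w) (D w') := fun w w' hne => by
    simp only [D, Finset.disjoint_union_left, Finset.disjoint_union_right]
    exact ⟨⟨disjoint_block (Or.inr (hf' hne)), disjoint_block (Or.inl huv.symm)⟩,
      disjoint_block (Or.inl huv), disjoint_block (Or.inr (hg' hne))⟩
  have hd : ∀ w, (D w).card = 2 * s := fun w => by
    rw [Finset.card_union_of_disjoint (disjoint_block (Or.inl huv)), card_block, card_block]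
    omega
  have hsub : {ω | ¬ HaveReferee (bitLottery s) p ω u v} ⊆ {ω | ∀ w, ω ∉ allTrue (D w)} := by
    intro ω hω w hmem
    refine hω ⟨f w, g w, (hf w).trans (hg w).symm, mem_coin.2 ?_, mem_coin.2 ?_⟩
    · exact fun x hx => hmem x (Finset.mem_union_left _ hx)
    · exact fun x hx => hmem x (Finset.mem_union_right _ hx)
  refine (measure_mono hsub).trans ?_
  rw [tapesLaw_forall_notMem_allTrue hD hd, hι]
  refine (one_sub_inv_pow_le_exp _ _).trans (ENNReal.ofReal_le_ofReal (Real.exp_le_exp.2 ?_))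
  have hn : (n : ℝ) ≤ (n - 2 : ℕ) + 2 := by exact_mod_cast (by omega : n ≤ n - 2 + 2)
  have h : ((2 : ℝ) ^ s - 2) * 2 ^ (2 * s) ≤ (n - 2 : ℕ) := by
    have h3 : (2 : ℝ) ^ s * 2 ^ (2 * s) ≤ n := by
      rw [← pow_add, show s + 2 * s = 3 * s by ring, pow_mul]
      exact_mod_cast h₁
    have h4 : (1 : ℝ) ≤ 2 ^ (2 * s) := one_le_pow₀ (by norm_num)
    linarith
  have := (le_div_iff₀ (by positivity)).2 h
  linarith

/-- The good event of the election with referees. -/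
structure Good (s : ℕ) (p : PortMapping n) (ω : Fin n → Tape) : Prop where
  exists_cand : ∃ v, ω v ∈ (bitLottery s).cand
  few_cand : ∀ K : Finset (Fin n), (∀ v ∈ K, ω v ∈ (bitLottery s).cand) → K.card ≤ 64 * 2 ^ s
  few_coins : ∀ v, ∀ K : Finset (Fin (n - 1)),
    (∀ i ∈ K, ω v ∈ (bitLottery s).coin i) → K.card ≤ 64 * 4 ^ s
  haveReferee : ∀ u v, u ≠ v → HaveReferee (bitLottery s) p ω u v

theorem measure_not_good_le (hn : 1 ≤ n) (h₁ : 8 ^ s ≤ n) (h₂ : n ≤ 8 * 8 ^ s)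
    (p : PortMapping n) :
    tapesLaw n {ω | ¬ Good s p ω} ≤ ENNReal.ofReal (4 * n ^ 2 * Real.exp (2 - 2 ^ s)) := by
  classical
  set ε := ENNReal.ofReal (Real.exp (2 - 2 ^ s)) with hε
  let B₁ : Set (Fin n → Tape) := {ω | ∀ v, ω v ∉ (bitLottery s).cand}
  let B₂ : Set (Fin n → Tape) :=
    {ω | 64 * 2 ^ s ≤ (Finset.univ.filter fun v => ω v ∈ (bitLottery s).cand).card}
  let B₃ : Fin n → Set (Fin n → Tape) := fun v => {ω | 64 * 4 ^ s ≤
    (Finset.univ.filter fun i : Fin (n - 1) => ω v ∈ (bitLottery s).coin i).card}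
  -- The event is empty on the diagonal, so the union may run over all pairs.
  let B₄ : Fin n × Fin n → Set (Fin n → Tape) := fun x =>
    {ω | x.1 ≠ x.2 ∧ ¬ HaveReferee (bitLottery s) p ω x.1 x.2}
  have hsub : {ω | ¬ Good s p ω} ⊆ (B₁ ∪ B₂) ∪ ((⋃ v, B₃ v) ∪ ⋃ x, B₄ x) := by
    intro ω hω
    by_contra hc
    simp only [Set.mem_union, Set.mem_iUnion, not_or, not_exists] at hc
    obtain ⟨⟨c₁, c₂⟩, c₃, c₄⟩ := hc
    refine hω ⟨?_, fun K hK => ?_, fun v K hK => ?_, fun u v huv => ?_⟩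
    · by_contra hne
      exact c₁ fun v hv => hne ⟨v, hv⟩
    · exact (Finset.card_le_card fun v hv => by simpa using hK v hv).trans (not_le.1 c₂).le
    · exact (Finset.card_le_card fun i hi => by simpa using hK i hi).trans (not_le.1 (c₃ v)).le
    · by_contra hne
      exact c₄ (u, v) ⟨huv, hne⟩
  have hB₄ : ∀ x, tapesLaw n (B₄ x) ≤ ε := fun x => by
    by_cases hx : x.1 = x.2
    · simp [B₄, hx]
    · exact (measure_mono fun ω hω => hω.2).trans (measure_no_referee_le h₁ p hx)
  calc tapesLaw n {ω | ¬ Good s p ω}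
      ≤ (ε + ε) + ((∑ v : Fin n, ε) + ∑ x : Fin n × Fin n, ε) := by
        refine (measure_mono hsub).trans ((measure_union_le _ _).trans (add_le_add
          ((measure_union_le _ _).trans (add_le_add ?_ ?_))
          ((measure_union_le _ _).trans (add_le_add ?_ ?_))))
        · exact measure_no_cand_le h₁
        · exact measure_many_cand_le h₂
        · exact (measure_iUnion_fintype_le _ _).trans
            (Finset.sum_le_sum fun v _ => measure_many_coins_le h₂ v)
        · exact (measure_iUnion_fintype_le _ _).trans (Finset.sum_le_sum fun x _ => hB₄ x)
    _ = ((2 + n + n * n : ℕ) : ℝ≥0∞) * ε := by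
        simp
        ring
    _ ≤ ((4 * n ^ 2 : ℕ) : ℝ≥0∞) * ε := by
        gcongr
        nlinarith
    _ = _ := by
        rw [hε, ← ENNReal.ofReal_natCast, ← ENNReal.ofReal_mul (by positivity)]
        push_cast
        rfl

/-- At most `64 * 2 ^ s` candidates with `64 * 4 ^ s` referees each cost `4096 * 8 ^ s ≤ 4096 * n`
messages; vetoes at most double this, and one announcement adds `n - 1`. -/
theorem Good.messages_le {ids : Fin n → ℤ} (hids : Function.Injective ids) {p : PortMapping n}
    {ω : Fin n → Tape} (h : Good s p ω) (h₁ : 8 ^ s ≤ n) :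
    (refereeElection n (bitLottery s)).messages ids p ω ≤ ((8193 * n : ℕ) : ℝ≥0∞) := by
  classical
  refine (refereeElection.messages_le h.exists_cand).trans (Nat.cast_le.2 ?_)
  have hA := Nat.mul_le_mul_right (n - 1) (card_announces_le_one hids h.haveReferee)
  have hR : (Finset.univ.filter fun x : Fin n × Fin (n - 1) =>
      ω x.1 ∈ (bitLottery s).cand ∧ ω x.1 ∈ (bitLottery s).coin x.2).card ≤ 4096 * 8 ^ s := by
    rw [Finset.card_eq_sum_card_fiberwise (f := Prod.fst)
      (t := Finset.univ.filter fun v => ω v ∈ (bitLottery s).cand)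
      (fun x hx => by simp at hx ⊢; exact hx.1)]
    refine (Finset.sum_le_card_nsmul _ _ (64 * 4 ^ s) fun v _ => ?_).trans ?_
    · rw [← Finset.card_image_of_injOn (f := Prod.snd)]
      · refine h.few_coins v _ fun i hi => ?_
        simp only [Finset.mem_image, Finset.mem_filter, Finset.mem_univ, true_and] at hi
        obtain ⟨x, ⟨hx, rfl⟩, rfl⟩ := hi
        exact hx.2
      · intro x hx y hy hxy
        simp only [Finset.coe_filter, Set.mem_ofPred_eq] at hx hy
        exact Prod.ext (hx.2.trans hy.2.symm) hxy
    · rw [smul_eq_mul]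
      refine (Nat.mul_le_mul_right _ (h.few_cand _ fun v hv => by simpa using hv)).trans ?_
      rw [show 8 = 2 * 4 by rfl, mul_pow]
      exact le_of_eq (by ring)
  omega

end bitLottery

theorem fullLottery_messages_le (ids : Fin n → ℤ) (p : PortMapping n) (ω : Fin n → Tape)
    (hn : 1 ≤ n) :
    (refereeElection n fullLottery).messages ids p ω ≤ ((n * n : ℕ) : ℝ≥0∞) := by
  classical
  refine (refereeElection.messages_le ⟨⟨0, hn⟩, Set.mem_univ _⟩).trans (Nat.cast_le.2 ?_)
  have h0 : (Finset.univ.filter fun x : Fin n × Fin (n - 1) =>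
      ω x.1 ∈ fullLottery.cand ∧ ω x.1 ∈ fullLottery.coin x.2).card = 0 := by
    simp [fullLottery]
  rw [h0, mul_zero, zero_add]
  refine Nat.mul_le_mul ((Finset.card_le_univ _).trans ?_) (Nat.sub_le _ _)
  simp

/-! ### Choice of the parameters -/

theorem exists_threshold (k : ℕ) : ∃ s₀ : ℕ, ∀ n s : ℕ, s₀ ≤ s → 1 ≤ n → n ≤ 8 * 8 ^ s →
    4 * (n : ℝ) ^ 2 * Real.exp (2 - 2 ^ s) ≤ 1 / (n : ℝ) ^ k := by
  have h1 : Filter.Tendsto (fun s : ℕ => (2 : ℝ) ^ s) Filter.atTop Filter.atTop :=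
    tendsto_pow_atTop_atTop_of_one_lt (by norm_num)
  -- Since `n ≤ 8 * (2 ^ s) ^ 3`, the factor `n ^ (k + 2)` has degree `3 * (k + 2)` in `2 ^ s`, and
  -- the exponential wins.
  have h2 := (((Real.tendsto_pow_mul_exp_neg_atTop_nhds_zero (3 * (k + 2))).comp h1).const_mul
    (4 * 8 ^ (k + 2) * Real.exp 2))
  rw [mul_zero] at h2
  obtain ⟨s₀, hs₀⟩ := Filter.eventually_atTop.1 (h2.eventually_le_const one_pos)
  refine ⟨s₀, fun n s hs hn hns => ?_⟩
  have hpos : (0 : ℝ) < n := by exact_mod_cast hn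
  rw [le_div_iff₀ (by positivity)]
  refine le_trans ?_ (hs₀ s hs)
  have h3 : (n : ℝ) ≤ 8 * (2 ^ s) ^ 3 := by
    rw [← pow_mul, mul_comm s, pow_mul]
    norm_num
    exact_mod_cast hns
  calc 4 * (n : ℝ) ^ 2 * Real.exp (2 - 2 ^ s) * n ^ k
      = 4 * (n : ℝ) ^ (k + 2) * Real.exp (2 - 2 ^ s) := by ring
    _ ≤ 4 * (8 * (2 ^ s) ^ 3) ^ (k + 2) * Real.exp (2 - 2 ^ s) := by gcongr
    _ = _ := by
      rw [Function.comp_apply, mul_pow, ← pow_mul, sub_eq_add_neg, Real.exp_add]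
      ring

theorem exists_refereeElection (k : ℕ) : ∃ (C : ℕ) (l : ℕ → Lottery), ∀ n : ℕ, 1 ≤ n →
    1 ≤ C ∧ ∀ (ids : Fin n ↪ ℤ) (p : PortMapping n),
      ENNReal.ofReal (1 - 1 / (n : ℝ) ^ k) ≤
        tapesLaw n {ω | (refereeElection n (l n)).messages ids p ω ≤ ((C * n : ℕ) : ℝ≥0∞) ∧
          ∀ v, ((refereeElection n (l n)).output ids p ω 3 v).isSome = true} := by
  obtain ⟨s₀, hs₀⟩ := exists_threshold k
  -- Below `8 ^ s₀` the tail bound is not available; there all nodes announce themselves, and `n * n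
  -- ≤ 8 ^ s₀ * n`.
  refine ⟨8193 + 8 ^ s₀, fun n => if n < 8 ^ s₀ then fullLottery else bitLottery (Nat.log 8 n),
    fun n hn => ⟨Nat.le_add_right_of_le (by norm_num), fun ids p => ?_⟩⟩
  dsimp only
  split_ifs with hlt
  · have huniv : {ω | (refereeElection n fullLottery).messages ids p ω ≤
        (((8193 + 8 ^ s₀) * n : ℕ) : ℝ≥0∞) ∧
        ∀ v, ((refereeElection n fullLottery).output ids p ω 3 v).isSome = true} = Set.univ := by
      refine Set.eq_univ_of_forall fun ω => ⟨?_, fun v =>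
        refereeElection.isSome_output_three ⟨v, Set.mem_univ _⟩ v⟩
      exact (fullLottery_messages_le ids p ω hn).trans
        (Nat.cast_le.2 (Nat.mul_le_mul_right _ (by omega)))
    rw [huniv, measure_univ]
    exact ENNReal.ofReal_le_one.2 (sub_le_self _ (by positivity))
  · have hlog : s₀ ≤ Nat.log 8 n := Nat.le_log_of_pow_le (by norm_num) (not_lt.1 hlt)
    have h₁ : 8 ^ Nat.log 8 n ≤ n := Nat.pow_log_le_self 8 (by omega)
    have h₂ : n ≤ 8 * 8 ^ Nat.log 8 n := by
      have := Nat.lt_pow_succ_log_self (b := 8) (by norm_num) n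
      rw [Nat.succ_eq_add_one, pow_succ'] at this
      exact this.le
    have hbad := (bitLottery.measure_not_good_le hn h₁ h₂ p).trans
      (ENNReal.ofReal_le_ofReal (hs₀ n _ hlog hn h₂))
    have hgood : {ω | bitLottery.Good (Nat.log 8 n) p ω} ⊆
        {ω | (refereeElection n (bitLottery (Nat.log 8 n))).messages ids p ω ≤
          (((8193 + 8 ^ s₀) * n : ℕ) : ℝ≥0∞) ∧ ∀ v, ((refereeElection n
            (bitLottery (Nat.log 8 n))).output ids p ω 3 v).isSome = true} := fun ω hω =>
      ⟨(hω.messages_le ids.injective h₁).trans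
        (Nat.cast_le.2 (Nat.mul_le_mul_right _ (Nat.le_add_right _ _))),
        refereeElection.isSome_output_three hω.exists_cand⟩
    refine le_trans ?_ (measure_mono hgood)
    rw [ENNReal.ofReal_sub _ (by positivity), ENNReal.ofReal_one, tsub_le_iff_right]
    -- Subadditivity replaces the complement rule, so `Good` need not be measurable.
    calc (1 : ℝ≥0∞) = tapesLaw n Set.univ := measure_univ.symm
      _ ≤ tapesLaw n ({ω | bitLottery.Good (Nat.log 8 n) p ω} ∪
          {ω | ¬ bitLottery.Good (Nat.log 8 n) p ω}) :=
        measure_mono fun ω _ => Classical.em _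
      _ ≤ _ := (measure_union_le _ _).trans (add_le_add_right hbad _)

end CliqueElection

open CliqueElection
theorem mainTheorem3 :
    -- every Las Vegas algorithm for implicit election needs `Ω(n)` messages in expectation
    (∃ c : ℝ, 0 < c ∧ ∀ n : ℕ, 2 ≤ n →
      ∀ U : Set ℤ, ((3 * n : ℕ) : ℕ∞) ≤ U.encard →
      ∀ A : Algorithm n Bool, A.IsLasVegas U ImplicitElection →
        ∃ ids : Fin n ↪ ℤ, (∀ v, ids v ∈ U) ∧ ∃ p : PortMapping n,
          ENNReal.ofReal (c * n) ≤ A.expectedMessages ids p) ∧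
    -- a Las Vegas algorithm for explicit election: `O(n)` messages and 3 rounds, both w.h.p.
    (∀ k : ℕ, ∃ (C : ℕ) (A : ∀ n : ℕ, Algorithm n ℤ), ∀ n : ℕ, 1 ≤ n →
      (A n).IsLasVegas Set.univ ExplicitElection ∧
      ∀ (ids : Fin n ↪ ℤ) (p : PortMapping n),
        ENNReal.ofReal (1 - 1 / (n : ℝ) ^ k) ≤
          tapesLaw n {ω | (A n).messages ids p ω ≤ ((C * n : ℕ) : ENNReal) ∧
            ∀ v, ((A n).output ids p ω 3 v).isSome = true} ∧
        -- message length: linear in the bit lengths of `n` and of the IDs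
        ∀ B : ℕ, (∀ v, (ids v).natAbs.size ≤ B) →
          ∀ ω t v i m, (A n).sent ids p ω t v i = some m → m.length ≤ C * (n.size + B)) := by
  refine ⟨⟨1 / 2, by norm_num, fun n hn U hU A hA => hA.exists_expectedMessages_ge hn hU⟩,
    fun k => ?_⟩
  obtain ⟨C, l, h⟩ := exists_refereeElection k
  refine ⟨C, fun n => refereeElection n (l n), fun n hn =>
    ⟨refereeElection.isLasVegas (l n) hn, fun ids p => ⟨(h n hn).2 ids p, ?_⟩⟩⟩
  intro B hB ω t v i m hm
  have h1 := refereeElection.length_le_of_sent hm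
  have h2 := hB v
  -- The at least one digit of `n` pays for the sign bit.
  have h3 : 0 < n.size := Nat.size_pos.2 hn
  calc m.length ≤ 1 * (n.size + B) := by omega
    _ ≤ C * (n.size + B) := Nat.mul_le_mul_right _ (h n hn).1
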